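/- Consider two service nodes $A$ and $B$, each with infinitely many servers, in a network that is empty at time $0$. Users arrive from outside at $A$ and at $B$ according to Poisson processes with rates $\lambda_A\ge 0$ and $\lambda_B\ge 0$. The service times at $A$ and $B$ are positive random variables with distribution functions $G_A$ and $G_B$ and finite means $\alpha_A$ and $\alpha_B$. A user who completes service at $A$ goes immediately to $B$ with probability $p\in[0,1]$ and otherwise leaves the system; a user who completes service at $B$ leaves the system. The two arrival processes, all service times and all routing decisions are mutually independent. Let $N_A(t)$ and $N_B(t)$ be the numbers of users at $A$ and $B$ at time $t\ge 0$. For every $t$ let $X_{A_1}(t),X_{A_2}(t),\dots$ be i.i.d. integrable random variables with mean $m_A(t)$, this sequence being independent of $N_A(t)$, and let $X_{B_1}(t),X_{B_2}(t),\dots$ be i.i.d. integrable random variables with mean $m_B(t)$, this sequence being independent of $N_B(t)$ (unitary contributions and unitary pensions). The system is in equilibrium at time $t$ if $$E\Big[\sum_{i=1}^{N_A(t)}X_{A_i}(t)\Big]=E\Big[\sum_{j=1}^{N_B(t)}X_{B_j}(t)\Big].$$ Both random sums are integrable for every $t$, and the following hold. 1. Suppose that the limits $m_A=\lim_{t\to\infty}m_A(t)$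 and $m_B=\lim_{t\to\infty}m_B(t)$ exist and are finite. Then, as $t\to\infty$, the left side of the equilibrium condition tends to $m_A\lambda_A\alpha_A$ and its right side tends to $m_B(p\lambda_A+\lambda_B)\alpha_B$. In particular, if the system is in equilibrium at all sufficiently large $t$, then $$m_A\lambda_A\alpha_A=m_B(p\lambda_A+\lambda_B)\alpha_B.$$ 2. If $G_A$ and $G_B$ are concentrated on $[0,a]$ and $[0,b]$ respectively, then for every $t\ge a+b$ the system is in equilibrium at time $t$ if and only if $$m_A(t)\lambda_A\alpha_A=m_B(t)(p\lambda_A+\lambda_B)\alpha_B.$$ -/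

import Mathlib

open MeasureTheory ProbabilityTheory Filter Set
open scoped Topology NNReal ENNReal

noncomputable section

namespace PensionFund

/-- The number of epochs `τ n ω` that are at most `t`. -/
def arrivalCount {Ω : Type*} (τ : ℕ → Ω → ℝ≥0∞) (t : ℝ≥0) (ω : Ω) : ℕ :=
  {n : ℕ | τ n ω ≤ (t : ℝ≥0∞)}.ncard

/-- `τ 0 ≤ τ 1 ≤ …` are the arrival epochs of a homogeneous Poisson process of rate `r` on
`[0, ∞)`: the process that counts them is a.s. finite, starts at `0`, and has independent
increments, the increment over `(s, t]` having the Poisson law of parameter `r * (t - s)`.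
The value `∞` stands for an arrival that never takes place, so that `r = 0` is allowed. -/
structure IsPoissonArrivals {Ω : Type*} [MeasurableSpace Ω] (τ : ℕ → Ω → ℝ≥0∞) (r : ℝ≥0)
    (μ : Measure Ω) : Prop where
  measurable : ∀ n, Measurable (τ n)
  monotone : ∀ᵐ ω ∂μ, Monotone fun n => τ n ω
  locally_finite : ∀ᵐ ω ∂μ, ∀ t : ℝ≥0, {n : ℕ | τ n ω ≤ (t : ℝ≥0∞)}.Finite
  count_zero : ∀ᵐ ω ∂μ, arrivalCount τ 0 ω = 0
  law_increment : ∀ s t : ℝ≥0, s ≤ t →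
    HasLaw (fun ω => arrivalCount τ t ω - arrivalCount τ s ω) (poissonMeasure (r * (t - s))) μ
  indep_increments : HasIndepIncrements (arrivalCount τ) μ

/-- The number of users present at time `t` at a node with infinitely many servers, where user
`n` arrives at `arr n`, immediately enters service and leaves at `arr n + serv n`. -/
def numberInService {Ω : Type*} (arr : ℕ → Ω → ℝ≥0∞) (serv : ℕ → Ω → ℝ) (t : ℝ≥0) (ω : Ω) : ℕ :=
  {n : ℕ | arr n ω ≤ (t : ℝ≥0∞) ∧ (t : ℝ≥0∞) < arr n ω + ENNReal.ofReal (serv n ω)}.ncard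

/-- The random elements that drive the two-node network. -/
structure Network (Ω : Type*) where
  /-- Arrival epoch at node `A` of the `n`-th user that comes from outside to `A`. -/
  arrA : ℕ → Ω → ℝ≥0∞
  /-- Service time at node `A` of this user. -/
  servA : ℕ → Ω → ℝ
  /-- Whether this user goes to node `B` after node `A` (otherwise the user leaves). -/
  route : ℕ → Ω → Bool
  /-- Service time of this user at node `B`, if the user goes there. -/
  servAB : ℕ → Ω → ℝ
  /-- Arrival epoch at node `B` of the `n`-th user that comes from outside directly to `B`. -/
  arrB : ℕ → Ω → ℝ≥0∞
  /-- Service time at node `B` of this user. -/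
  servB : ℕ → Ω → ℝ

namespace Network

variable {Ω : Type*}

/-- Arrival epoch at `B` of the `n`-th user of `A`: the epoch of departure from `A` if the user is
routed to `B`, and `∞` (never) otherwise. -/
def transfer (S : Network Ω) (n : ℕ) (ω : Ω) : ℝ≥0∞ :=
  if S.route n ω = true then S.arrA n ω + ENNReal.ofReal (S.servA n ω) else ∞

/-- `N_A(t)`, the number of users at node `A` at time `t` (the network is empty initially). -/
def numberA (S : Network Ω) (t : ℝ≥0) (ω : Ω) : ℕ :=
  numberInService S.arrA S.servA t ω

/-- `N_B(t)`, the number of users at node `B` at time `t`: those routed from `A` and those who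
came directly from outside. -/
def numberB (S : Network Ω) (t : ℝ≥0) (ω : Ω) : ℕ :=
  numberInService S.transfer S.servAB t ω + numberInService S.arrB S.servB t ω

end Network

/-- The probabilistic assumptions on the network: Poisson external arrivals with rates `lA`, `lB`;
service times with laws `GA`, `GB`; routing from `A` to `B` with probability `p`; the two arrival
processes and all service times and routing decisions are mutually independent. -/
structure IsFundNetwork {Ω : Type*} [MeasurableSpace Ω] (S : Network Ω) (lA lB : ℝ≥0)
    (p : unitInterval) (GA GB : Measure ℝ) (μ : Measure Ω) : Prop where
  arrA_poisson : IsPoissonArrivals S.arrA lA μ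
  arrB_poisson : IsPoissonArrivals S.arrB lB μ
  measurable_servA : ∀ n, Measurable (S.servA n)
  measurable_route : ∀ n, Measurable (S.route n)
  measurable_servAB : ∀ n, Measurable (S.servAB n)
  measurable_servB : ∀ n, Measurable (S.servB n)
  /-- For each user of `A`, the service at `A`, the routing and the service at `B` are independent
  with the prescribed laws. -/
  law_marksA : ∀ n, HasLaw (fun ω => (S.servA n ω, S.route n ω, S.servAB n ω))
    (GA.prod ((bernoulliMeasure true false p).prod GB)) μ
  indep_marksA : iIndepFun (fun n ω => (S.servA n ω, S.route n ω, S.servAB n ω)) μ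
  law_servB : ∀ n, HasLaw (S.servB n) GB μ
  indep_servB : iIndepFun S.servB μ
  indep_arrA_marksA : IndepFun (fun ω n => S.arrA n ω)
    (fun ω n => (S.servA n ω, S.route n ω, S.servAB n ω)) μ
  indep_arrB_servB : IndepFun (fun ω n => S.arrB n ω) (fun ω n => S.servB n ω) μ
  /-- The users of `A` are independent of the users who come directly to `B`. -/
  indep_A_B : IndepFun
    (fun ω => ((fun n => S.arrA n ω : ℕ → ℝ≥0∞),
      (fun n => (S.servA n ω, S.route n ω, S.servAB n ω) : ℕ → ℝ × Bool × ℝ)))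
    (fun ω => ((fun n => S.arrB n ω : ℕ → ℝ≥0∞), (fun n => S.servB n ω : ℕ → ℝ))) μ

/-- `X 0, X 1, …` are i.i.d. integrable unitary payments with mean `m`, independent of the number
`N` of individuals who make or receive them. -/
structure IsUnitaryPayments {Ω : Type*} [MeasurableSpace Ω] (X : ℕ → Ω → ℝ) (m : ℝ)
    (N : Ω → ℕ) (μ : Measure Ω) : Prop where
  indep : iIndepFun X μ
  identDistrib : ∀ i, IdentDistrib (X i) (X 0) μ μ
  integrable : ∀ i, Integrable (X i) μ
  mean : ∀ i, ∫ ω, X i ω ∂μ = m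
  indep_number : IndepFun N (fun ω i => X i ω) μ

/-- The random rate `X_1 + ⋯ + X_N` at which `N` individuals pay or are paid. -/
def paymentRate {Ω : Type*} (N : Ω → ℕ) (X : ℕ → Ω → ℝ) (ω : Ω) : ℝ :=
  ∑ i ∈ Finset.range (N ω), X i ω

/-- The fund is in equilibrium at time `t`: the expected rate at which contributions are received
equals the expected rate at which pensions are paid. -/
def InEquilibrium {Ω : Type*} [MeasurableSpace Ω] (S : Network Ω) (XA XB : ℝ≥0 → ℕ → Ω → ℝ)
    (μ : Measure Ω) (t : ℝ≥0) : Prop :=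
  ∫ ω, paymentRate (S.numberA t) (XA t) ω ∂μ = ∫ ω, paymentRate (S.numberB t) (XB t) ω ∂μ

end PensionFund

end

namespace PensionFund

/-! Wald's identity (`IsUnitaryPayments.integrable_and_integral_eq`) turns each side of the
equilibrium condition into `m(t) * E N(t)`, so only the first moments of the two head counts matter,
not their laws.

For these, the only Poisson input is that the intensity measure is `r` times Lebesgue measure on
`(0, ∞)` (`IsPoissonArrivals.tsum_measure_Ioc`). A user whose stay of length `y` begins a time `x`
after the arrival is present at time `t` iff the arrival falls in `(t - x - y, t - x]`, and the part
of this window after time `0` has length `min y (t - x)`, truncated at `0`. Integrating over marks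
independent of the epochs gives `E N(t) = r * ∫ min y (t - x)`
(`IsPoissonArrivals.lintegral_present`). Node `A` and direct users of `B` have `x = 0`; for users
routed to `B`, `x` is the service time at `A`.

The integrand is at most `y` and equals `y` once `t ≥ x + y`. Dominated convergence gives the
limits, and service times bounded by `a` and `b` give equality for `t ≥ a + b`. -/

lemma lintegral_natCast_poissonMeasure (r : ℝ≥0) :
    ∫⁻ n, (n : ℝ≥0∞) ∂(poissonMeasure r) = r := by
  have hs : HasSum (fun n : ℕ => Real.exp (-r) * r ^ n / n.factorial * n) (r : ℝ) := by
    -- The term at `0` vanishes, and the shifted series is `r` times the total mass.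
    rw [← hasSum_nat_add_iff' 1]
    have h := (hasSum_one_poissonMeasure r).mul_left (r : ℝ)
    simp only [Finset.range_one, Finset.sum_singleton, Nat.cast_zero, mul_zero, sub_zero]
    rw [mul_one] at h
    refine h.congr_fun fun n => ?_
    rw [Nat.factorial_succ]
    push_cast
    have : (n.factorial : ℝ) ≠ 0 := by positivity
    field_simp
    ring
  rw [poissonMeasure, lintegral_sum_measure]
  simp only [lintegral_smul_measure, lintegral_dirac, smul_eq_mul]
  have h0 : ∀ n : ℕ, 0 ≤ Real.exp (-r) * r ^ n / n.factorial := fun n => by positivity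
  calc _ = ∑' n : ℕ, ENNReal.ofReal (Real.exp (-r) * r ^ n / n.factorial * n) := by
        refine tsum_congr fun n => ?_
        rw [ENNReal.ofReal_mul (h0 n), ENNReal.ofReal_natCast]
    _ = r := by
        rw [← ENNReal.ofReal_tsum_of_nonneg (fun n => mul_nonneg (h0 n) n.cast_nonneg) hs.summable,
          hs.tsum_eq, ENNReal.ofReal_coe_nnreal]

/-! ### Measurability and mean of the number of events that occur -/

lemma natCast_ncard_eq_tsum_indicator {Ω : Type*} {A : ℕ → Set Ω} {ω : Ω}
    (h : {n | ω ∈ A n}.Finite) :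
    (({n | ω ∈ A n}.ncard : ℕ) : ℝ≥0∞) = ∑' n, (A n).indicator 1 ω := by
  have h1 := ENNReal.tsum_set_one {n | ω ∈ A n}
  rw [← h.cast_ncard_eq, tsum_subtype {n | ω ∈ A n} (fun _ => (1 : ℝ≥0∞))] at h1
  simpa [indicator] using h1.symm

lemma aemeasurable_ncard {Ω : Type*} [MeasurableSpace Ω] {μ : Measure Ω} {A : ℕ → Set Ω}
    (hA : ∀ n, MeasurableSet (A n)) (h : ∀ᵐ ω ∂μ, {n | ω ∈ A n}.Finite) :
    AEMeasurable (fun ω => {n | ω ∈ A n}.ncard) μ := by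
  -- An everywhere measurable version: the floor only serves to return to `ℕ`.
  refine ⟨fun ω => ⌊(∑' n, (A n).indicator (1 : Ω → ℝ≥0∞) ω).toReal⌋₊, ?_, ?_⟩
  · exact (Measurable.tsum fun n => measurable_one.indicator (hA n)).ennreal_toReal.nat_floor
  · filter_upwards [h] with ω hω
    rw [← natCast_ncard_eq_tsum_indicator hω]
    simp

lemma lintegral_ncard {Ω : Type*} [MeasurableSpace Ω] {μ : Measure Ω} {A : ℕ → Set Ω}
    (hA : ∀ n, MeasurableSet (A n)) (h : ∀ᵐ ω ∂μ, {n | ω ∈ A n}.Finite) :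
    ∫⁻ ω, ({n | ω ∈ A n}.ncard : ℝ≥0∞) ∂μ = ∑' n, μ (A n) := by
  rw [lintegral_congr_ae (h.mono fun ω hω => natCast_ncard_eq_tsum_indicator hω),
    lintegral_tsum fun n => (measurable_one.indicator (hA n)).aemeasurable]
  simp [hA]

/-! ### Poisson arrivals with independent marks -/

section Poisson

variable {Ω : Type*} [MeasurableSpace Ω] {μ : Measure Ω} {τ : ℕ → Ω → ℝ≥0∞} {r : ℝ≥0}

/-- The sum is the expected number of epochs in the interval, which is the mean of the Poisson
increment. -/
lemma IsPoissonArrivals.tsum_measure_Ioc (h : IsPoissonArrivals τ r μ) {s t : ℝ≥0} (hst : s ≤ t) :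
    ∑' n, μ {ω | τ n ω ∈ Ioc (s : ℝ≥0∞) t} = r * (t - s : ℝ≥0) := by
  have hm : ∀ n, MeasurableSet {ω | τ n ω ∈ Ioc (s : ℝ≥0∞) t} :=
    fun n => h.measurable n measurableSet_Ioc
  have hst' : (s : ℝ≥0∞) ≤ t := by exact_mod_cast hst
  have hf : ∀ᵐ ω ∂μ, {n | ω ∈ {ω | τ n ω ∈ Ioc (s : ℝ≥0∞) t}}.Finite :=
    h.locally_finite.mono fun ω hω => (hω t).subset fun n hn => hn.2
  rw [← lintegral_ncard hm hf]
  have hL := h.law_increment s t hst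
  have hP := lintegral_natCast_poissonMeasure (r * (t - s))
  rw [← hL.map_eq, lintegral_map' (by fun_prop) hL.aemeasurable] at hP
  rw [ENNReal.coe_mul] at hP
  rw [← hP]
  refine lintegral_congr_ae (h.locally_finite.mono fun ω hω => ?_)
  have hsub : {n | τ n ω ≤ (s : ℝ≥0∞)} ⊆ {n | τ n ω ≤ (t : ℝ≥0∞)} := fun n hn => hn.trans hst'
  have : {n | ω ∈ {ω | τ n ω ∈ Ioc (s : ℝ≥0∞) t}}
      = {n | τ n ω ≤ (t : ℝ≥0∞)} \ {n | τ n ω ≤ (s : ℝ≥0∞)} := by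
    ext n; simp [and_comm]
  simp only [this, arrivalCount, ncard_sdiff hsub (hω s)]

/-- Needed because a window truncated at time `0` becomes `(0, t - x]`, which omits its left
endpoint. -/
lemma IsPoissonArrivals.ae_pos (h : IsPoissonArrivals τ r μ) : ∀ᵐ ω ∂μ, ∀ n, 0 < τ n ω := by
  filter_upwards [h.count_zero, h.locally_finite] with ω h0 hf n
  by_contra hn
  have h1 := (ncard_eq_zero (hf 0)).1 h0
  have : n ∈ {n : ℕ | τ n ω ≤ ((0 : ℝ≥0) : ℝ≥0∞)} := by simpa using hn
  rw [h1] at this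
  exact this

/-- The expected number of arrivals whose stay of length `y`, delayed by `x`, covers `t`. -/
lemma IsPoissonArrivals.tsum_measure_present (h : IsPoissonArrivals τ r μ) (t x y : ℝ≥0) :
    ∑' n, μ {ω | τ n ω + x ≤ t ∧ (t : ℝ≥0∞) < τ n ω + x + y} = r * (min y (t - x) : ℝ≥0) := by
  rcases lt_or_ge t x with hx | hx
  · have : ∀ a : ℝ≥0∞, ¬ (a + x ≤ t) := fun a ha =>
      (lt_of_lt_of_le (by exact_mod_cast hx : (t : ℝ≥0∞) < x) le_add_self).not_ge ha
    simp [this, tsub_eq_zero_of_le hx.le]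
  -- The window of admissible epochs is `(t - x - min y (t - x), t - x]`.
  · have hle : t - x - min y (t - x) ≤ t - x := tsub_le_self
    have := h.tsum_measure_Ioc hle
    rw [tsub_tsub_cancel_of_le (min_le_right _ _)] at this
    rw [← this]
    refine tsum_congr fun n => measure_congr ?_
    filter_upwards [h.ae_pos] with ω hω
    refine propext ?_
    change (τ n ω + x ≤ t ∧ (t : ℝ≥0∞) < τ n ω + x + y) ↔ τ n ω ∈ Ioc _ _
    have hp := hω n
    rcases eq_or_ne (τ n ω) ∞ with ha | ha
    · simp [ha]
    · lift τ n ω to ℝ≥0 using ha with a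
      rw [mem_Ioc]
      norm_cast at hp ⊢
      rw [← NNReal.coe_lt_coe, ← NNReal.coe_le_coe, ← NNReal.coe_lt_coe, ← NNReal.coe_le_coe,
        NNReal.coe_sub (min_le_right _ _), NNReal.coe_min, NNReal.coe_sub hx]
      rw [← NNReal.coe_pos] at hp
      push_cast
      rcases min_cases (y : ℝ) (t - x) with ⟨h1, h2⟩ | ⟨h1, h2⟩ <;> rw [h1] <;>
        constructor <;> rintro ⟨h3, h4⟩ <;> constructor <;> linarith

variable {E : Type*} {M : ℕ → Ω → E} {D : Set E} {x y : E → ℝ≥0}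

/-- Arrival epochs and marks of the users who are present at time `t`. -/
def presentSet (D : Set E) (x y : E → ℝ≥0) (t : ℝ≥0) : Set (ℝ≥0∞ × E) :=
  {q | q.2 ∈ D ∧ q.1 + x q.2 ≤ t ∧ (t : ℝ≥0∞) < q.1 + x q.2 + y q.2}

lemma IsPoissonArrivals.ae_finite_present (h : IsPoissonArrivals τ r μ) (t : ℝ≥0) :
    ∀ᵐ ω ∂μ, {n | ω ∈ {ω | (τ n ω, M n ω) ∈ presentSet D x y t}}.Finite :=
  h.locally_finite.mono fun _ hω => (hω t).subset fun _ hn => le_self_add.trans hn.2.1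

variable [MeasurableSpace E] {ν : Measure E}

lemma measurableSet_presentSet (hD : MeasurableSet D) (hx : Measurable x) (hy : Measurable y)
    (t : ℝ≥0) : MeasurableSet (presentSet D x y t) := by
  have h1 : MeasurableSet {q : ℝ≥0∞ × E | q.1 + x q.2 ≤ t} :=
    measurableSet_le (by fun_prop) (by fun_prop)
  have h2 : MeasurableSet {q : ℝ≥0∞ × E | (t : ℝ≥0∞) < q.1 + x q.2 + y q.2} :=
    measurableSet_lt (by fun_prop) (by fun_prop)
  exact (measurable_snd hD).inter (h1.inter h2)

lemma IsPoissonArrivals.aemeasurable_present (h : IsPoissonArrivals τ r μ)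
    (hM : ∀ n, Measurable (M n)) (hD : MeasurableSet D) (hx : Measurable x) (hy : Measurable y)
    (t : ℝ≥0) :
    AEMeasurable (fun ω => {n | (τ n ω, M n ω) ∈ presentSet D x y t}.ncard) μ :=
  aemeasurable_ncard (A := fun n => {ω | (τ n ω, M n ω) ∈ presentSet D x y t})
    (fun n => ((h.measurable n).prodMk (hM n)) (measurableSet_presentSet hD hx hy t))
    (h.ae_finite_present t)

/-- The expected number of users present at time `t`. -/
lemma IsPoissonArrivals.lintegral_present [IsFiniteMeasure μ] [SFinite ν]
    (h : IsPoissonArrivals τ r μ)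
    (hM : ∀ n, Measurable (M n)) (hν : ∀ n, HasLaw (M n) ν μ)
    (hi : ∀ n, IndepFun (τ n) (M n) μ)
    (hD : MeasurableSet D) (hx : Measurable x) (hy : Measurable y) (t : ℝ≥0) :
    ∫⁻ ω, ({n | (τ n ω, M n ω) ∈ presentSet D x y t}.ncard : ℝ≥0∞) ∂μ
      = r * ∫⁻ m in D, (min (y m) (t - x m) : ℝ≥0) ∂ν := by
  have hP := measurableSet_presentSet hD hx hy t
  have h1 := lintegral_ncard (A := fun n => {ω | (τ n ω, M n ω) ∈ presentSet D x y t})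
    (fun n => ((h.measurable n).prodMk (hM n)) hP) (h.ae_finite_present (μ := μ) t)
  refine h1.trans ?_
  have h2 : ∀ n, μ {ω | (τ n ω, M n ω) ∈ presentSet D x y t}
      -- Independence makes the joint law a product, so the mark can be frozen by Tonelli.
      = ∫⁻ m, μ {ω | (τ n ω, m) ∈ presentSet D x y t} ∂ν := fun n => by
    have := (indepFun_iff_map_prod_eq_prod_map_map (h.measurable n).aemeasurable
      (hM n).aemeasurable).1 (hi n)
    rw [(hν n).map_eq] at this
    change μ ((fun ω => (τ n ω, M n ω)) ⁻¹' presentSet D x y t) = _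
    rw [← Measure.map_apply ((h.measurable n).prodMk (hM n)) hP, this,
      Measure.prod_apply_symm hP]
    refine lintegral_congr fun m => ?_
    rw [Measure.map_apply (h.measurable n) (measurable_prodMk_right hP)]
    rfl
  simp_rw [h2]
  -- Summing over users inside the integral leaves the deterministic-mark count for each `m`.
  rw [← lintegral_tsum, ← lintegral_const_mul _ (by fun_prop), ← lintegral_indicator hD]
  · refine lintegral_congr fun m => ?_
    by_cases hm : m ∈ D
    · simp only [presentSet, mem_ofPred_eq, hm, true_and, indicator_of_mem]
      exact h.tsum_measure_present t (x m) (y m)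
    · simp [presentSet, hm]
  · intro n
    have : Measurable fun m => (μ.map (τ n)) ((fun a => (a, m)) ⁻¹' presentSet D x y t) :=
      measurable_measure_prodMk_right hP
    simp_rw [Measure.map_apply (h.measurable n) (measurable_prodMk_right hP)] at this
    exact this.aemeasurable

lemma tendsto_setLIntegral_min_sub (hx : Measurable x) (hy : Measurable y)
    (hfin : ∫⁻ m in D, y m ∂ν ≠ ∞) :
    Tendsto (fun t : ℝ≥0 => ∫⁻ m in D, (min (y m) (t - x m) : ℝ≥0) ∂ν) atTop
      (𝓝 (∫⁻ m in D, y m ∂ν)) := by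
  refine tendsto_lintegral_filter_of_dominated_convergence (fun m => (y m : ℝ≥0∞))
    (Eventually.of_forall fun t => by fun_prop)
    (Eventually.of_forall fun t => Eventually.of_forall fun m => ?_) hfin
    (Eventually.of_forall fun m => ?_)
  · exact_mod_cast min_le_left _ _
  · refine tendsto_const_nhds.congr' ?_
    filter_upwards [eventually_ge_atTop (x m + y m)] with t ht
    rw [min_eq_left (le_tsub_of_add_le_left ht)]

end Poisson

/-! ### Wald's identity -/

section Wald

variable {Ω : Type*} [MeasurableSpace Ω] {μ : Measure Ω} [IsProbabilityMeasure μ]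
  {X : ℕ → Ω → ℝ} {m : ℝ} {N : Ω → ℕ}

/-- Wald's identity for a number of summands that is independent of the summands. -/
lemma IsUnitaryPayments.integrable_and_integral_eq (h : IsUnitaryPayments X m N μ)
    (hN : AEMeasurable N μ) (hfin : ∫⁻ ω, (N ω : ℝ≥0∞) ∂μ ≠ ∞) :
    Integrable (paymentRate N X) μ ∧
      ∫ ω, paymentRate N X ω ∂μ = m * (∫⁻ ω, (N ω : ℝ≥0∞) ∂μ).toReal := by
  -- The random sum is the series of `1_{i < N} * X i`, whose two factors are independent.
  let g : ℕ → ℕ → ℝ := fun i k => if i < k then 1 else 0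
  let F : ℕ → Ω → ℝ := fun i ω => g i (N ω) * X i ω
  have hgm : ∀ i, AEMeasurable (fun ω => g i (N ω)) μ := fun i =>
    (measurable_of_countable (g i)).comp_aemeasurable hN
  have hind : ∀ i, IndepFun (fun ω => g i (N ω)) (X i) μ := fun i =>
    h.indep_number.comp (measurable_of_countable (g i)) (measurable_pi_apply i)
  have hg_int : ∀ i, Integrable (fun ω => g i (N ω)) μ := fun i =>
    Integrable.of_bound (hgm i).aestronglyMeasurable 1
      (Eventually.of_forall fun ω => by dsimp only [g]; split_ifs <;> simp)
  have hF_int : ∀ i, Integrable (F i) μ := fun i => (hind i).integrable_mul (hg_int i) (h.integrable i)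
  have hg_nonneg : ∀ i k, 0 ≤ g i k := fun i k => by dsimp only [g]; split_ifs <;> simp
  have hF_norm : ∀ i, ∫ ω, ‖F i ω‖ ∂μ = (∫ ω, g i (N ω) ∂μ) * ∫ ω, |X 0 ω| ∂μ := fun i => by
    have h1 : IndepFun (fun ω => g i (N ω)) (fun ω => |X i ω|) μ :=
      (hind i).comp measurable_id measurable_norm
    have h2 := h1.integral_fun_mul_eq_mul_integral (hgm i).aestronglyMeasurable
      (h.integrable i).abs.aestronglyMeasurable
    have h3 : ∫ ω, |X i ω| ∂μ = ∫ ω, |X 0 ω| ∂μ :=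
      ((h.identDistrib i).comp measurable_norm).integral_eq
    rw [← h3, ← h2]
    refine integral_congr_ae (Eventually.of_forall fun ω => ?_)
    simp only [F, norm_mul, Real.norm_eq_abs, abs_of_nonneg (hg_nonneg _ _)]
  -- Tail-sum formula: `E N = ∑ P(i < N)`.
  have hg_sum : HasSum (fun i => ∫ ω, g i (N ω) ∂μ) (∫⁻ ω, (N ω : ℝ≥0∞) ∂μ).toReal := by
    have h1 : ∀ k : ℕ, (k : ℝ≥0∞) = ∑' i, ENNReal.ofReal (g i k) := fun k => by
      rw [tsum_eq_sum (s := Finset.range k) fun i hi => by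
        rw [show g i k = 0 from if_neg (by simpa using hi), ENNReal.ofReal_zero]]
      rw [Finset.sum_congr rfl fun i hi => by
        rw [show g i k = 1 from if_pos (Finset.mem_range.1 hi), ENNReal.ofReal_one]]
      simp
    have h2 : ∫⁻ ω, (N ω : ℝ≥0∞) ∂μ = ∑' i, ENNReal.ofReal (∫ ω, g i (N ω) ∂μ) := by
      simp_rw [h1]
      rw [lintegral_tsum fun i => (hgm i).ennreal_ofReal]
      refine tsum_congr fun i => (ofReal_integral_eq_lintegral_ofReal (hg_int i) ?_).symm
      exact Eventually.of_forall fun ω => hg_nonneg _ _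
    have h3 : ∀ i, (ENNReal.ofReal (∫ ω, g i (N ω) ∂μ)).toReal = ∫ ω, g i (N ω) ∂μ := fun i =>
      ENNReal.toReal_ofReal (integral_nonneg fun ω => hg_nonneg _ _)
    have h4 := ENNReal.hasSum_toReal (h2 ▸ hfin)
    rw [h2, ENNReal.tsum_toReal_eq fun i => ENNReal.ofReal_ne_top]
    simpa only [h3] using h4
  -- The total is `E N * E|X 0|`; its finiteness gives integrability and permits termwise
  -- integration.
  have hF_sum : Summable fun i => ∫ ω, ‖F i ω‖ ∂μ := by
    simp_rw [hF_norm]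
    exact (hg_sum.mul_right _).summable
  have hrate : ∀ ω, HasSum (fun i => F i ω) (paymentRate N X ω) := fun ω => by
    have : paymentRate N X ω = ∑ i ∈ Finset.range (N ω), F i ω :=
      Finset.sum_congr rfl fun i hi => by
        simp [F, show g i (N ω) = 1 from if_pos (Finset.mem_range.1 hi)]
    rw [this]
    exact hasSum_sum_of_ne_finset_zero fun i hi => by
      simp [F, show g i (N ω) = 0 from if_neg (by simpa using hi)]
  have hrate' : paymentRate N X = fun ω => ∑' i, F i ω := funext fun ω => (hrate ω).tsum_eq.symm
  constructor
  · refine ⟨aestronglyMeasurable_of_tendsto_ae atTop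
      (f := fun n ω => ∑ i ∈ Finset.range n, F i ω)
      (fun n => Finset.aestronglyMeasurable_fun_sum _ fun i _ => (hF_int i).1)
      (Eventually.of_forall fun ω => (hrate ω).tendsto_sum_nat), ?_⟩
    refine lt_of_le_of_lt (lintegral_mono fun ω => ?_ : _ ≤ ∫⁻ ω, ∑' i, ‖F i ω‖ₑ ∂μ) ?_
    · rw [hrate']
      exact enorm_tsum_le_tsum_enorm
    · rw [lintegral_tsum fun i => (hF_int i).1.enorm]
      simp_rw [← ofReal_integral_norm_eq_lintegral_enorm (hF_int _)]
      rw [← ENNReal.ofReal_tsum_of_nonneg (fun i => integral_nonneg fun ω => norm_nonneg _) hF_sum]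
      exact ENNReal.ofReal_lt_top
  · have h1 := hasSum_integral_of_summable_integral_norm hF_int hF_sum
    rw [← hrate'] at h1
    refine h1.unique ?_
    rw [mul_comm]
    refine (hg_sum.mul_right m).congr_fun fun i => ?_
    rw [← h.mean i]
    exact (hind i).integral_fun_mul_eq_mul_integral (hgm i).aestronglyMeasurable
      (h.integrable i).aestronglyMeasurable

end Wald

/-! ### The two nodes as marked Poisson arrivals -/

lemma lintegral_toNNReal_eq_ofReal_integral {G : Measure ℝ} (hpos : ∀ᵐ x ∂G, 0 < x)
    (hint : Integrable (fun x : ℝ => x) G) :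
    ∫⁻ x, (x.toNNReal : ℝ≥0∞) ∂G = ENNReal.ofReal (∫ x, x ∂G) :=
  (ofReal_integral_eq_lintegral_ofReal hint (hpos.mono fun _ hx => hx.le)).symm

/-- The routing event is a product set, so the integral factors, the Bernoulli factor contributing
`p`. -/
lemma setLIntegral_routed (p : unitInterval) (GA GB : Measure ℝ) [IsProbabilityMeasure GA]
    [IsProbabilityMeasure GB] {f : ℝ → ℝ≥0∞} (hf : Measurable f) :
    ∫⁻ m in {m : ℝ × Bool × ℝ | m.2.1 = true}, f m.2.2
        ∂(GA.prod ((bernoulliMeasure true false p).prod GB))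
      = ENNReal.ofReal p * ∫⁻ y, f y ∂GB := by
  have hset : {m : ℝ × Bool × ℝ | m.2.1 = true} = univ ×ˢ ({true} ×ˢ univ) := by
    ext; simp
  rw [hset, ← Measure.prod_restrict, ← Measure.prod_restrict, Measure.restrict_univ,
    Measure.restrict_univ, lintegral_prod _ (by fun_prop)]
  dsimp only
  rw [lintegral_const, measure_univ, mul_one,
    lintegral_prod _ (by fun_prop)]
  dsimp only
  rw [lintegral_const, mul_comm, Measure.restrict_apply_univ,
    bernoulliMeasure_apply_of_mem_of_notMem p (measurableSet_singleton _) (by simp) (by simp)]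
  congr 1
  rw [← ENNReal.ofReal_coe_nnreal]
  rfl

variable {Ω : Type*}

lemma numberInService_eq_ncard_presentSet (arr : ℕ → Ω → ℝ≥0∞) (serv : ℕ → Ω → ℝ) (t : ℝ≥0) :
    numberInService arr serv t =
      fun ω => {n | (arr n ω, serv n ω) ∈ presentSet univ (fun _ => 0) Real.toNNReal t}.ncard := by
  funext ω
  simp [numberInService, presentSet, ENNReal.ofReal]

/-- Users routed to `B` are viewed as delayed arrivals at `A`, so the law of the departure process
from `A` is never needed. An unrouted user has transfer epoch `∞`, which matches exclusion from the
mark set. -/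
lemma numberInService_transfer (S : Network Ω) (t : ℝ≥0) :
    numberInService S.transfer S.servAB t =
      fun ω => {n | (S.arrA n ω, S.servA n ω, S.route n ω, S.servAB n ω) ∈
        presentSet {m : ℝ × Bool × ℝ | m.2.1 = true} (fun m => m.1.toNNReal)
          (fun m => m.2.2.toNNReal) t}.ncard := by
  funext ω
  unfold numberInService
  congr 1
  ext n
  by_cases h : S.route n ω = true <;>
    simp [Network.transfer, presentSet, ENNReal.ofReal, h]

variable [MeasurableSpace Ω] {S : Network Ω} {lA lB : ℝ≥0} {p : unitInterval}
  {GA GB : Measure ℝ} {μ : Measure Ω}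

lemma IsFundNetwork.measurable_marksA (hS : IsFundNetwork S lA lB p GA GB μ) (n : ℕ) :
    Measurable fun ω => (S.servA n ω, S.route n ω, S.servAB n ω) :=
  (hS.measurable_servA n).prodMk ((hS.measurable_route n).prodMk (hS.measurable_servAB n))

lemma IsFundNetwork.indepFun_arrA_marksA (hS : IsFundNetwork S lA lB p GA GB μ) (n : ℕ) :
    IndepFun (S.arrA n) (fun ω => (S.servA n ω, S.route n ω, S.servAB n ω)) μ :=
  hS.indep_arrA_marksA.comp (measurable_pi_apply n) (measurable_pi_apply n)

lemma IsFundNetwork.aemeasurable_numberA (hS : IsFundNetwork S lA lB p GA GB μ) (t : ℝ≥0) :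
    AEMeasurable (S.numberA t) μ := by
  change AEMeasurable (numberInService _ _ t) μ
  rw [numberInService_eq_ncard_presentSet]
  exact hS.arrA_poisson.aemeasurable_present hS.measurable_servA .univ measurable_const
    measurable_real_toNNReal t

lemma IsFundNetwork.aemeasurable_numberB (hS : IsFundNetwork S lA lB p GA GB μ) (t : ℝ≥0) :
    AEMeasurable (S.numberB t) μ := by
  change AEMeasurable (numberInService S.transfer S.servAB t + numberInService _ _ t) μ
  rw [numberInService_transfer, numberInService_eq_ncard_presentSet]
  refine AEMeasurable.add ?_ ?_
  · exact hS.arrA_poisson.aemeasurable_present hS.measurable_marksA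
      (measurable_snd.fst (measurableSet_singleton true)) (by fun_prop) (by fun_prop) t
  · exact hS.arrB_poisson.aemeasurable_present hS.measurable_servB .univ measurable_const
      measurable_real_toNNReal t

/-! ### Expected head counts: bounds, limits and exact values -/

section Expectation

variable [IsProbabilityMeasure μ] [IsProbabilityMeasure GA] [IsProbabilityMeasure GB]

lemma IsFundNetwork.lintegral_numberA (hS : IsFundNetwork S lA lB p GA GB μ) (t : ℝ≥0) :
    ∫⁻ ω, (S.numberA t ω : ℝ≥0∞) ∂μ
      = lA * ∫⁻ x in univ, (min x.toNNReal (t - 0) : ℝ≥0) ∂GA := by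
  change ∫⁻ ω, (numberInService _ _ t ω : ℝ≥0∞) ∂μ = _
  rw [numberInService_eq_ncard_presentSet]
  refine hS.arrA_poisson.lintegral_present hS.measurable_servA (fun n => ⟨?_, ?_⟩)
    (fun n => ?_) .univ measurable_const measurable_real_toNNReal t
  · exact (hS.measurable_servA n).aemeasurable
  · have := (hS.law_marksA n).map_eq
    -- The law of the service at `A` is the first marginal of the joint mark law.
    have h2 := congrArg (Measure.map Prod.fst) this
    rw [Measure.map_map measurable_fst (hS.measurable_marksA n), Measure.map_fst_prod] at h2
    simpa [Function.comp_def] using h2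
  · exact (hS.indepFun_arrA_marksA n).comp measurable_id measurable_fst

lemma IsFundNetwork.lintegral_numberB (hS : IsFundNetwork S lA lB p GA GB μ) (t : ℝ≥0) :
    ∫⁻ ω, (S.numberB t ω : ℝ≥0∞) ∂μ
      = lA * ∫⁻ m in {m : ℝ × Bool × ℝ | m.2.1 = true},
          (min m.2.2.toNNReal (t - m.1.toNNReal) : ℝ≥0)
          ∂(GA.prod ((bernoulliMeasure true false p).prod GB))
        + lB * ∫⁻ x in univ, (min x.toNNReal (t - 0) : ℝ≥0) ∂GB := by
  have hD : MeasurableSet {m : ℝ × Bool × ℝ | m.2.1 = true} :=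
    measurable_snd.fst (measurableSet_singleton true)
  have hi : ∀ n, IndepFun (S.arrB n) (S.servB n) μ := fun n =>
    hS.indep_arrB_servB.comp (measurable_pi_apply n) (measurable_pi_apply n)
  have hx : Measurable fun m : ℝ × Bool × ℝ => m.1.toNNReal := by fun_prop
  have hy : Measurable fun m : ℝ × Bool × ℝ => m.2.2.toNNReal := by fun_prop
  have h1 := hS.arrA_poisson.lintegral_present hS.measurable_marksA hS.law_marksA
    hS.indepFun_arrA_marksA hD hx hy t
  have h2 := hS.arrB_poisson.lintegral_present hS.measurable_servB hS.law_servB hi .univ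
    (x := fun _ => 0) measurable_const measurable_real_toNNReal t
  have h3 := hS.arrA_poisson.aemeasurable_present hS.measurable_marksA hD hx hy t
  have h4 := (measurable_of_countable (Nat.cast : ℕ → ℝ≥0∞)).comp_aemeasurable h3
  rw [← h1, ← h2]
  simp only [Network.numberB, Nat.cast_add]
  rw [numberInService_transfer, numberInService_eq_ncard_presentSet]
  exact lintegral_add_left' h4 _

variable {αA αB : ℝ}

lemma IsFundNetwork.lintegral_numberA_le (hS : IsFundNetwork S lA lB p GA GB μ)
    (hA : ∫⁻ x, (x.toNNReal : ℝ≥0∞) ∂GA = ENNReal.ofReal αA) (t : ℝ≥0) :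
    ∫⁻ ω, (S.numberA t ω : ℝ≥0∞) ∂μ ≤ lA * ENNReal.ofReal αA := by
  rw [hS.lintegral_numberA, setLIntegral_univ, ← hA]
  gcongr
  exact min_le_left _ _

lemma IsFundNetwork.tendsto_lintegral_numberA (hS : IsFundNetwork S lA lB p GA GB μ)
    (hA : ∫⁻ x, (x.toNNReal : ℝ≥0∞) ∂GA = ENNReal.ofReal αA) :
    Tendsto (fun t => ∫⁻ ω, (S.numberA t ω : ℝ≥0∞) ∂μ) atTop (𝓝 (lA * ENNReal.ofReal αA)) := by
  simp_rw [hS.lintegral_numberA]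
  refine ENNReal.Tendsto.const_mul ?_ (Or.inr ENNReal.coe_ne_top)
  rw [← hA, ← setLIntegral_univ]
  refine tendsto_setLIntegral_min_sub (x := fun _ => 0) measurable_const measurable_real_toNNReal ?_
  rw [setLIntegral_univ, hA]
  exact ENNReal.ofReal_ne_top

lemma IsFundNetwork.lintegral_numberA_eq (hS : IsFundNetwork S lA lB p GA GB μ)
    (hA : ∫⁻ x, (x.toNNReal : ℝ≥0∞) ∂GA = ENNReal.ofReal αA) {t : ℝ≥0}
    (h : ∀ᵐ x : ℝ ∂GA, x ≤ t) :
    ∫⁻ ω, (S.numberA t ω : ℝ≥0∞) ∂μ = lA * ENNReal.ofReal αA := by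
  rw [hS.lintegral_numberA, setLIntegral_univ, ← hA]
  congr 1
  refine lintegral_congr_ae (h.mono fun x hx => ?_)
  simp only [tsub_zero]
  rw [min_eq_left (Real.toNNReal_le_iff_le_coe.2 hx)]

lemma IsFundNetwork.lintegral_numberB_le (hS : IsFundNetwork S lA lB p GA GB μ)
    (hB : ∫⁻ x, (x.toNNReal : ℝ≥0∞) ∂GB = ENNReal.ofReal αB) (t : ℝ≥0) :
    ∫⁻ ω, (S.numberB t ω : ℝ≥0∞) ∂μ
      ≤ lA * (ENNReal.ofReal p * ENNReal.ofReal αB) + lB * ENNReal.ofReal αB := by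
  rw [hS.lintegral_numberB, setLIntegral_univ, ← hB,
    ← setLIntegral_routed p GA GB (f := fun y => (y.toNNReal : ℝ≥0∞)) (by fun_prop)]
  gcongr
  · exact min_le_left _ _
  · exact min_le_left _ _

lemma IsFundNetwork.tendsto_lintegral_numberB (hS : IsFundNetwork S lA lB p GA GB μ)
    (hB : ∫⁻ x, (x.toNNReal : ℝ≥0∞) ∂GB = ENNReal.ofReal αB) :
    Tendsto (fun t => ∫⁻ ω, (S.numberB t ω : ℝ≥0∞) ∂μ) atTop
      (𝓝 (lA * (ENNReal.ofReal p * ENNReal.ofReal αB) + lB * ENNReal.ofReal αB)) := by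
  simp_rw [hS.lintegral_numberB]
  have hr := setLIntegral_routed p GA GB (f := fun y => (y.toNNReal : ℝ≥0∞)) (by fun_prop)
  rw [hB] at hr
  refine Tendsto.add (ENNReal.Tendsto.const_mul ?_ (Or.inr ENNReal.coe_ne_top))
    (ENNReal.Tendsto.const_mul ?_ (Or.inr ENNReal.coe_ne_top))
  · rw [← hr]
    refine tendsto_setLIntegral_min_sub (x := fun m : ℝ × Bool × ℝ => m.1.toNNReal)
      (y := fun m : ℝ × Bool × ℝ => m.2.2.toNNReal) (by fun_prop) (by fun_prop) ?_
    rw [hr]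
    exact ENNReal.mul_ne_top ENNReal.ofReal_ne_top ENNReal.ofReal_ne_top
  · rw [← hB, ← setLIntegral_univ]
    refine tendsto_setLIntegral_min_sub (x := fun _ => 0) measurable_const
      measurable_real_toNNReal ?_
    rw [setLIntegral_univ, hB]
    exact ENNReal.ofReal_ne_top

lemma IsFundNetwork.lintegral_numberB_eq (hS : IsFundNetwork S lA lB p GA GB μ)
    (hB : ∫⁻ x, (x.toNNReal : ℝ≥0∞) ∂GB = ENNReal.ofReal αB) {a b : ℝ≥0} {t : ℝ≥0}
    (ha : ∀ᵐ x : ℝ ∂GA, x ≤ a) (hb : ∀ᵐ x : ℝ ∂GB, x ≤ b) (hab : a + b ≤ t) :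
    ∫⁻ ω, (S.numberB t ω : ℝ≥0∞) ∂μ
      = lA * (ENNReal.ofReal p * ENNReal.ofReal αB) + lB * ENNReal.ofReal αB := by
  rw [hS.lintegral_numberB, setLIntegral_univ, ← hB,
    ← setLIntegral_routed p GA GB (f := fun y => (y.toNNReal : ℝ≥0∞)) (by fun_prop)]
  congr 2
  · refine lintegral_congr_ae (ae_restrict_of_ae ?_)
    have h1 := (Measure.quasiMeasurePreserving_fst (μ := GA)
      (ν := (bernoulliMeasure true false p).prod GB)).ae ha
    have h2 := ((Measure.quasiMeasurePreserving_snd (μ := bernoulliMeasure true false p)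
      (ν := GB)).comp (Measure.quasiMeasurePreserving_snd (μ := GA))).ae hb
    filter_upwards [h1, h2] with m hm1 hm2
    rw [min_eq_left]
    -- Delay plus stay is at most `a + b ≤ t`, so the minimum is the full service time at `B`.
    refine le_tsub_of_add_le_left (le_trans ?_ hab)
    exact add_le_add (Real.toNNReal_le_iff_le_coe.2 hm1) (Real.toNNReal_le_iff_le_coe.2 hm2)
  · refine lintegral_congr_ae (hb.mono fun x hx => ?_)
    simp only [tsub_zero]
    rw [min_eq_left ((Real.toNNReal_le_iff_le_coe.2 hx).trans (le_add_self.trans hab))]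

end Expectation

end PensionFund

/-! ### The equilibrium conditions -/

theorem mainTheorem1 {Ω : Type*} [MeasurableSpace Ω] (μ : Measure Ω) [IsProbabilityMeasure μ]
    (S : PensionFund.Network Ω) (lA lB : ℝ≥0) (p : unitInterval)
    (GA GB : Measure ℝ) [IsProbabilityMeasure GA] [IsProbabilityMeasure GB]
    (hGA_pos : ∀ᵐ x ∂GA, 0 < x) (hGB_pos : ∀ᵐ x ∂GB, 0 < x)
    (hGA_mean : Integrable (fun x : ℝ => x) GA) (hGB_mean : Integrable (fun x : ℝ => x) GB)
    (αA αB : ℝ) (hαA : αA = ∫ x, x ∂GA) (hαB : αB = ∫ x, x ∂GB)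
    (hS : PensionFund.IsFundNetwork S lA lB p GA GB μ)
    (XA XB : ℝ≥0 → ℕ → Ω → ℝ) (mA mB : ℝ≥0 → ℝ)
    (hXA : ∀ t, PensionFund.IsUnitaryPayments (XA t) (mA t) (S.numberA t) μ)
    (hXB : ∀ t, PensionFund.IsUnitaryPayments (XB t) (mB t) (S.numberB t) μ) :
    -- the expected rates that the equilibrium condition compares are finite
    (∀ t, Integrable (PensionFund.paymentRate (S.numberA t) (XA t)) μ ∧
      Integrable (PensionFund.paymentRate (S.numberB t) (XB t)) μ) ∧
    -- the limiting form of the equilibrium condition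
    (∀ MA MB : ℝ, Tendsto mA atTop (𝓝 MA) → Tendsto mB atTop (𝓝 MB) →
      Tendsto (fun t => ∫ ω, PensionFund.paymentRate (S.numberA t) (XA t) ω ∂μ) atTop
        (𝓝 (MA * lA * αA)) ∧
      Tendsto (fun t => ∫ ω, PensionFund.paymentRate (S.numberB t) (XB t) ω ∂μ) atTop
        (𝓝 (MB * (p * lA + lB) * αB)) ∧
      ((∀ᶠ t in atTop, PensionFund.InEquilibrium S XA XB μ t) →
        MA * lA * αA = MB * (p * lA + lB) * αB)) ∧
    -- bounded service times: the condition has this form at every time `t ≥ a + b`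
    (∀ a b : ℝ, (∀ᵐ x ∂GA, x ∈ Icc 0 a) → (∀ᵐ x ∂GB, x ∈ Icc 0 b) →
      ∀ t : ℝ≥0, a + b ≤ t →
        (PensionFund.InEquilibrium S XA XB μ t ↔
          mA t * lA * αA = mB t * (p * lA + lB) * αB)) := by
  have hA := PensionFund.lintegral_toNNReal_eq_ofReal_integral hGA_pos hGA_mean
  have hB := PensionFund.lintegral_toNNReal_eq_ofReal_integral hGB_pos hGB_mean
  rw [← hαA] at hA
  rw [← hαB] at hB
  have hA0 : 0 ≤ αA := hαA ▸ integral_nonneg_of_ae (hGA_pos.mono fun _ hx => hx.le)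
  have hB0 : 0 ≤ αB := hαB ▸ integral_nonneg_of_ae (hGB_pos.mono fun _ hx => hx.le)
  have hLA : (lA * ENNReal.ofReal αA : ℝ≥0∞) ≠ ∞ :=
    ENNReal.mul_ne_top ENNReal.coe_ne_top ENNReal.ofReal_ne_top
  have hLB : (lA * (ENNReal.ofReal p * ENNReal.ofReal αB) + lB * ENNReal.ofReal αB : ℝ≥0∞) ≠ ∞ :=
    ENNReal.add_ne_top.2 ⟨ENNReal.mul_ne_top ENNReal.coe_ne_top
      (ENNReal.mul_ne_top ENNReal.ofReal_ne_top ENNReal.ofReal_ne_top),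
      ENNReal.mul_ne_top ENNReal.coe_ne_top ENNReal.ofReal_ne_top⟩
  have hLA' : (lA * ENNReal.ofReal αA : ℝ≥0∞).toReal = lA * αA := by
    simp [ENNReal.toReal_ofReal hA0]
  have hLB' : (lA * (ENNReal.ofReal p * ENNReal.ofReal αB) + lB * ENNReal.ofReal αB :
      ℝ≥0∞).toReal = (p * lA + lB) * αB := by
    rw [ENNReal.toReal_add (ENNReal.add_ne_top.1 hLB).1 (ENNReal.add_ne_top.1 hLB).2]
    simp only [ENNReal.toReal_mul, ENNReal.toReal_ofReal hB0, ENNReal.toReal_ofReal p.2.1,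
      ENNReal.coe_toReal]
    ring
  have hWA := fun t => (hXA t).integrable_and_integral_eq (hS.aemeasurable_numberA t)
    (ne_top_of_le_ne_top hLA (hS.lintegral_numberA_le hA t))
  have hWB := fun t => (hXB t).integrable_and_integral_eq (hS.aemeasurable_numberB t)
    (ne_top_of_le_ne_top hLB (hS.lintegral_numberB_le hB t))
  refine ⟨fun t => ⟨(hWA t).1, (hWB t).1⟩, fun MA MB hMA hMB => ?_, fun a b ha hb t ht => ?_⟩
  · have hTA : Tendsto (fun t => ∫ ω, PensionFund.paymentRate (S.numberA t) (XA t) ω ∂μ) atTop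
        (𝓝 (MA * lA * αA)) := by
      simp_rw [fun t => (hWA t).2]
      rw [mul_assoc, ← hLA']
      exact hMA.mul ((ENNReal.tendsto_toReal hLA).comp (hS.tendsto_lintegral_numberA hA))
    have hTB : Tendsto (fun t => ∫ ω, PensionFund.paymentRate (S.numberB t) (XB t) ω ∂μ) atTop
        (𝓝 (MB * (p * lA + lB) * αB)) := by
      simp_rw [fun t => (hWB t).2]
      rw [mul_assoc, ← hLB']
      exact hMB.mul ((ENNReal.tendsto_toReal hLB).comp (hS.tendsto_lintegral_numberB hB))
    exact ⟨hTA, hTB, fun heq => tendsto_nhds_unique (hTA.congr' heq) hTB⟩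
  -- A probability measure concentrated on `Icc 0 a` forces `0 ≤ a`; likewise for `b`.
  · obtain ⟨x, hx⟩ := ha.exists
    obtain ⟨y, hy⟩ := hb.exists
    lift a to ℝ≥0 using hx.1.trans hx.2
    lift b to ℝ≥0 using hy.1.trans hy.2
    have hab : a + b ≤ t := by exact_mod_cast ht
    have ha' : ∀ᵐ x : ℝ ∂GA, x ≤ a := ha.mono fun _ h => h.2
    have hb' : ∀ᵐ x : ℝ ∂GB, x ≤ b := hb.mono fun _ h => h.2
    have hat : (a : ℝ) ≤ t := by exact_mod_cast le_self_add.trans hab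
    rw [PensionFund.InEquilibrium, (hWA t).2, (hWB t).2,
      hS.lintegral_numberA_eq hA (ha'.mono fun _ h => h.trans hat),
      hS.lintegral_numberB_eq hB ha' hb' hab, hLA', hLB', mul_assoc, mul_assoc]
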